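/- All hypergraphs are finite (finite vertex set $V$, edge set a set of subsets of $V$) and every edge has at least two vertices; they need not be uniform. For $X\subseteq V(\mathcal G)$, the induced subhypergraph $\mathcal G[X]$ has vertex set $X$ and edge set $\{e\in E(\mathcal G): e\subseteq X\}$. A hypergraph is $\mathcal F$-free if none of its induced subhypergraphs is isomorphic to $\mathcal F$. The chromatic number $\chi(\mathcal G)$ is the minimum number of colours in a vertex colouring of $\mathcal G$ with no monochromatic edge; $\mathcal G$ is strongly $t$-colourable if its vertices can be coloured with $t$ colours so that no edge contains two distinct vertices of the same colour. $\mathcal G$ covers a pair of distinct vertices if some edge of $\mathcal G$ contains both. Theorem. For every hypergraph $\mathcal F$ with at least one edge there is a constant $c_{\mathcal F}$ such that for every $n\in\mathbb N$ there is a hypergraph $\mathcal G$ with the following properties: 1. $\chi(\mathcal G)\ge n$; 2. every $\mathcal F$-free induced subhypergraph of $\mathcal G$ is strongly $c_{\mathcal F}$-colourable; 3. for every $X\subseteq V(\mathcal G)$ such that $\mathcal G$ covers every pair of distinct vertices of $X$, the hypergraph $\mathcal G[X]$ is isomorphic to an induced subhypergraph of $\mathcal F$. -/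

import Mathlib

namespace Hypergraph

universe u v

/-- The standing conventions on hypergraphs: finitely many vertices, and every edge contains at
least two vertices. -/
structure IsStandard {α : Type u} (H : Hypergraph α) : Prop where
  finite_vertexSet : H.vertexSet.Finite
  two_le_encard : ∀ e ∈ H.edgeSet, 2 ≤ e.encard

/-- The subhypergraph `H[X]` induced on a set `X` of vertices: its vertex set is `X`, its edges are
the edges of `H` contained in `X`. -/
def induce {α : Type u} (H : Hypergraph α) (X : Set α) : Hypergraph α where
  vertexSet := X
  edgeSet := {e | e ∈ H.edgeSet ∧ e ⊆ X}
  subset_vertexSet_of_mem_edgeSet' := fun _ he => he.2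

/-- Two hypergraphs are isomorphic if some bijection between their vertex sets carries edges to
edges and non-edges to non-edges. -/
def IsIsomorphic {α : Type u} {β : Type v} (H : Hypergraph α) (K : Hypergraph β) : Prop :=
  ∃ φ : H.vertexSet ≃ K.vertexSet, ∀ s : Set H.vertexSet,
    Subtype.val '' s ∈ H.edgeSet ↔ Subtype.val '' (φ '' s) ∈ K.edgeSet

/-- `F` is (up to isomorphism) an induced subhypergraph of `H`. -/
def IsInducedSubhypergraph {α : Type u} {β : Type v} (F : Hypergraph α) (H : Hypergraph β) :
    Prop :=
  ∃ X ⊆ H.vertexSet, F.IsIsomorphic (H.induce X)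

/-- `H` is `F`-free: it does not contain `F` as an induced subhypergraph. -/
def IsFree {α : Type u} {β : Type v} (H : Hypergraph β) (F : Hypergraph α) : Prop :=
  ¬ F.IsInducedSubhypergraph H

/-- `H` is (weakly) `n`-colourable: its vertices can be coloured with `n` colours such that no edge
is monochromatic. -/
def IsColorable {α : Type u} (H : Hypergraph α) (n : ℕ) : Prop :=
  ∃ κ : H.vertexSet → Fin n, ∀ e ∈ H.edgeSet, ¬ ∃ i, ∀ x : H.vertexSet, x.1 ∈ e → κ x = i

/-- The (weak) chromatic number: the least `n` such that `H` is `n`-colourable, and `⊤` if there is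
no such `n`. -/
noncomputable def chromaticNumber {α : Type u} (H : Hypergraph α) : ℕ∞ :=
  ⨅ n ∈ {n : ℕ | H.IsColorable n}, (n : ℕ∞)

/-- `H` is strongly `n`-colourable: its vertices can be coloured with `n` colours such that no edge
contains two distinct vertices of the same colour. -/
def IsStronglyColorable {α : Type u} (H : Hypergraph α) (n : ℕ) : Prop :=
  ∃ κ : H.vertexSet → Fin n, ∀ e ∈ H.edgeSet, ∀ x y : H.vertexSet,
    x.1 ∈ e → y.1 ∈ e → x ≠ y → κ x ≠ κ y

/-- `H` covers every pair of distinct vertices of `X`: some edge contains both of them. -/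
def CoversPairs {α : Type u} (H : Hypergraph α) (X : Set α) : Prop :=
  X.Pairwise H.Adj

end Hypergraph

open Set

namespace Hypergraph

/-! ### Posets with additive lengths -/

/-- Along chains of the order the function `l` is additive. -/
def IsAdditiveLength {V M : Type*} [PartialOrder V] [Add M] (l : V → V → M) : Prop :=
  ∀ ⦃u v w : V⦄, u ≤ v → v ≤ w → l u w = l u v + l v w

theorem IsAdditiveLength.self {V M : Type*} [PartialOrder V] [AddGroup M] {l : V → V → M}
    (h : IsAdditiveLength l) (u : V) : l u u = 0 := by
  have := h (le_refl u) (le_refl u)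
  simpa using this

/-- The relation obtained from `m` disjoint copies of an order `V` by adding, for every choice of
one element in each copy, a new element above the chosen ones. -/
def ZykovLE {V : Type*} [PartialOrder V] {m : ℕ} :
    (Fin m × V) ⊕ (Fin m → V) → (Fin m × V) ⊕ (Fin m → V) → Prop
  | .inl (i, u), .inl (j, v) => i = j ∧ u ≤ v
  | .inl (i, u), .inr w => u ≤ w i
  | .inr _, .inl _ => False
  | .inr w, .inr w' => w = w'

/-- The order given by `ZykovLE`. -/
abbrev zykovOrder (V : Type*) [PartialOrder V] (m : ℕ) :
    PartialOrder ((Fin m × V) ⊕ (Fin m → V)) where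
  le := ZykovLE
  lt x y := ZykovLE x y ∧ ¬ ZykovLE y x
  le_refl x := by rcases x with ⟨i, u⟩ | w <;> simp [ZykovLE]
  le_trans x y z := by
    rcases x with ⟨i, u⟩ | w <;> rcases y with ⟨j, v⟩ | w' <;> rcases z with ⟨k, x⟩ | w'' <;>
      simp only [ZykovLE, false_implies, implies_true, imp_false, and_imp]
    · rintro rfl h rfl h'
      exact ⟨rfl, h.trans h'⟩
    · rintro rfl h h'
      exact h.trans h'
    · rintro h rfl
      exact h
    · rintro - h
      exact h
    · rintro rfl rfl
      rfl
  le_antisymm x y := by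
    rcases x with ⟨i, u⟩ | w <;> rcases y with ⟨j, v⟩ | w' <;>
      simp only [ZykovLE, false_implies, implies_true, and_imp]
    · rintro rfl h - h'
      rw [le_antisymm h h']
    · rintro rfl -
      rfl

/-- The lengths on `zykovOrder` in which every new element covers the chosen ones by a step of
length one. -/
def zykovLength {V M : Type*} [AddGroupWithOne M] (l : V → V → M) (m : ℕ) :
    (Fin m × V) ⊕ (Fin m → V) → (Fin m × V) ⊕ (Fin m → V) → M
  | .inl (_, u), .inl (_, v) => l u v
  | .inl (i, u), .inr w => l u (w i) + 1
  | .inr _, _ => 0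

/-- New elements are maximal, so a chain that reaches one picks up the extra 1 exactly once. -/
theorem IsAdditiveLength.zykov {V M : Type*} [PartialOrder V] [AddGroupWithOne M] {l : V → V → M}
    (h : IsAdditiveLength l) (m : ℕ) :
    letI := zykovOrder V m
    IsAdditiveLength (zykovLength l m) := by
  intro x y z hxy hyz
  rcases x with ⟨i, u⟩ | w <;> rcases y with ⟨j, v⟩ | w' <;> rcases z with ⟨k, x⟩ | w''
  · exact h hxy.2 hyz.2
  · obtain ⟨rfl, hxy⟩ := hxy
    simp only [zykovLength]
    rw [h hxy hyz, add_assoc]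
  · exact hyz.elim
  · cases (show w' = w'' from hyz)
    simp [zykovLength]
  · exact hxy.elim
  · exact hxy.elim
  · exact hyz.elim
  · simp [zykovLength]

/-- There are finite orders with additive lengths whose steps of length one form a graph of
arbitrarily large chromatic number. -/
theorem exists_additiveLength_not_colorable (M : Type*) [AddGroupWithOne M] (n : ℕ) :
    ∃ (V : Type) (_ : PartialOrder V) (_ : Finite V) (_ : Nonempty V) (l : V → V → M), IsAdditiveLength l ∧
      ∀ κ : V → Fin n, ∃ u v, u < v ∧ l u v = 1 ∧ κ u = κ v := by
  induction n with
  | zero =>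
    exact ⟨Unit, inferInstance, inferInstance, inferInstance, fun _ _ => 0, by intro; simp,
      fun κ => (κ ()).elim0⟩
  | succ n ih =>
    obtain ⟨V, _, _, _, l, hl, hV⟩ := ih
    refine ⟨_, zykovOrder V (n + 1), inferInstance, inferInstance, zykovLength l (n + 1),
      hl.zykov _, fun κ => ?_⟩
    let := zykovOrder V (n + 1)
    -- Either copy `i` avoids colour `i`, and induction applies to it, or each copy `i` has an
    -- element of colour `i`, and the new element above these repeats one of their colours.
    by_cases hκ : ∃ i, ∀ u, κ (.inl (i, u)) ≠ i
    · obtain ⟨i, hi⟩ := hκ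
      obtain ⟨u, v, huv, h1, hc⟩ := hV fun u => (finSuccAboveEquiv i).symm ⟨κ (.inl (i, u)), hi u⟩
      refine ⟨.inl (i, u), .inl (i, v), lt_of_le_of_ne ⟨rfl, huv.le⟩ ?_, h1, ?_⟩
      · simpa using huv.ne
      · simpa using hc
    · push Not at hκ
      choose w hw using hκ
      refine ⟨.inl (κ (.inr w), w (κ (.inr w))), .inr w, lt_of_le_of_ne ?_ (by simp), ?_, hw _⟩
      · exact le_refl (w (κ (.inr w)))
      · simp [zykovLength, hl.self]

/-! ### Walks and the colouring by longest walks -/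

/-- Some walk with `m` steps along `R` ends in the given vertex. -/
def EndsWalk {V : Type*} (R : V → V → Prop) : ℕ → V → Prop
  | 0, _ => True
  | m + 1, v => ∃ u, R u v ∧ EndsWalk R m u

theorem EndsWalk.exists_walk {V : Type*} {R : V → V → Prop} {m : ℕ} {v : V}
    (h : EndsWalk R m v) : ∃ x : ℕ → V, x m = v ∧ ∀ i < m, R (x i) (x (i + 1)) := by
  induction m generalizing v with
  | zero => exact ⟨fun _ => v, rfl, by simp⟩
  | succ m ih =>
    obtain ⟨u, hu, hw⟩ := h
    obtain ⟨x, rfl, hx⟩ := ih hw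
    refine ⟨fun i => if i ≤ m then x i else v, by simp, fun i hi => ?_⟩
    rcases Nat.lt_succ_iff_lt_or_eq.1 hi with hi | rfl
    · have h1 : i ≤ m := hi.le
      have h2 : i + 1 ≤ m := hi
      simpa [h1, h2] using hx i hi
    · simpa using hu

/-- A relation without walks of `L` steps has a strictly monotone labelling by `L` labels. -/
theorem exists_lt_of_no_walk {V : Type*} (R : V → V → Prop) (L : ℕ)
    (h : ¬ ∃ x : ℕ → V, ∀ i < L, R (x i) (x (i + 1))) :
    ∃ f : V → Fin L, ∀ u v, R u v → f u < f v := by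
  classical
  have hend : ∀ v, ¬ EndsWalk R L v := fun v hv =>
    let ⟨x, _, hx⟩ := hv.exists_walk
    h ⟨x, hx⟩
  -- The label is the length of a longest walk ending at `v`; the walk of length 0 makes the default
  -- value of `findGreatest` legitimate.
  have hlt : ∀ v, Nat.findGreatest (EndsWalk R · v) L < L := fun v =>
    lt_of_le_of_ne (Nat.findGreatest_le _) fun he =>
      hend v (he ▸ Nat.findGreatest_spec (P := (EndsWalk R · v)) (Nat.zero_le L) trivial)
  refine ⟨fun v => ⟨Nat.findGreatest (EndsWalk R · v) L, hlt v⟩, fun u v huv => ?_⟩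
  exact Nat.le_findGreatest (P := (EndsWalk R · v)) (hlt u)
    ⟨u, huv, Nat.findGreatest_spec (P := (EndsWalk R · u)) (Nat.zero_le L) trivial⟩

/-! ### Generic families -/

/-- `(d, e, f)` is a rearrangement of `(a, b, c)`. -/
def IsRearrangement {α : Type*} (a b c d e f : α) : Prop :=
  (a = d ∧ (b = e ∧ c = f ∨ b = f ∧ c = e)) ∨ (a = e ∧ (b = d ∧ c = f ∨ b = f ∧ c = d)) ∨
    (a = f ∧ (b = d ∧ c = e ∨ b = e ∧ c = d))

/-- Sums of three members of the family `r` on `S` are equal only if they agree up to order. -/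
def IsGeneric {α M : Type*} [Add M] (r : α → M) (S : Set α) : Prop :=
  ∀ a ∈ S, ∀ b ∈ S, ∀ c ∈ S, ∀ d ∈ S, ∀ e ∈ S, ∀ f ∈ S, r a + r b + r c = r d + r e + r f →
    IsRearrangement a b c d e f

/-- Modulo 7 only `c 0` survives, and `|c 0| ≤ 3` forces it to vanish; then divide by 7. The bound 3
fits differences of two sums of three powers. -/
theorem eq_zero_of_sum_pow_seven (k : ℕ) (c : ℕ → ℤ) (hc : ∀ i, |c i| ≤ 3)
    (h : ∑ i ∈ Finset.range k, c i * 7 ^ i = 0) : ∀ i < k, c i = 0 := by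
  induction k generalizing c with
  | zero => simp
  | succ k ih =>
    rw [Finset.sum_range_succ'] at h
    have h' : ∑ i ∈ Finset.range k, c (i + 1) * 7 ^ (i + 1)
        = 7 * ∑ i ∈ Finset.range k, c (i + 1) * 7 ^ i := by
      rw [Finset.mul_sum]
      exact Finset.sum_congr rfl fun i _ => by ring
    rw [h'] at h
    have h0 := abs_le.1 (hc 0)
    simp only [pow_zero, mul_one] at h
    have hc0 : c 0 = 0 := by omega
    rintro (_ | i) hi
    · exact hc0
    · exact ih (fun i => c (i + 1)) (fun i => hc _) (by omega) i (by omega)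

theorem isRearrangement_of_pow_seven_add {a b c d e f : ℕ}
    (h : 7 ^ a + 7 ^ b + 7 ^ c = 7 ^ d + 7 ^ e + 7 ^ f) : IsRearrangement a b c d e f := by
  set k := a + b + c + d + e + f + 1 with hk
  let δ : ℕ → ℕ → ℤ := fun x i => if i = x then 1 else 0
  have hs : ∀ x < k, ∑ i ∈ Finset.range k, δ x i * 7 ^ i = 7 ^ x := fun x hx => by
    simp [δ, hx]
  have hδ : ∀ x i, δ x i = 0 ∨ δ x i = 1 := fun x i => by
    by_cases hx : i = x <;> simp [δ, hx]
  have key := eq_zero_of_sum_pow_seven k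
    (fun i => δ a i + δ b i + δ c i - δ d i - δ e i - δ f i)
    (fun i => by
      have := hδ a i; have := hδ b i; have := hδ c i
      have := hδ d i; have := hδ e i; have := hδ f i
      rw [abs_le]; omega)
    (by
      simp only [sub_mul, add_mul, Finset.sum_sub_distrib, Finset.sum_add_distrib]
      rw [hs a (by omega), hs b (by omega), hs c (by omega), hs d (by omega), hs e (by omega),
        hs f (by omega)]
      have : (7 ^ a + 7 ^ b + 7 ^ c : ℤ) = 7 ^ d + 7 ^ e + 7 ^ f := by exact_mod_cast h
      linarith)
  have ha := key a (by omega)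
  have hb := key b (by omega)
  have hc := key c (by omega)
  clear key hs hδ h
  simp only [δ] at ha hb hc
  clear_value k
  unfold IsRearrangement
  grind

theorem isGeneric_pow_seven {α : Type*} {S : Set α} {idx : α → ℕ} (hinj : InjOn idx S) {k p : ℕ}
    (hk : ∀ a ∈ S, idx a < k) (hp : 3 * 7 ^ k < p) :
    IsGeneric (fun a => ((7 ^ idx a : ℕ) : ZMod p)) S := by
  intro a ha b hb c hc d hd e he f hf h
  have hle : ∀ x ∈ S, 7 ^ idx x ≤ 7 ^ k := fun x hx =>
    Nat.pow_le_pow_right (by norm_num) (hk x hx).le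
  have h' : 7 ^ idx a + 7 ^ idx b + 7 ^ idx c = 7 ^ idx d + 7 ^ idx e + 7 ^ idx f := by
    have h1 := hle a ha; have h2 := hle b hb; have h3 := hle c hc
    have h4 := hle d hd; have h5 := hle e he; have h6 := hle f hf
    apply Nat.ModEq.eq_of_lt_of_lt (m := p) _ (by omega) (by omega)
    rw [← ZMod.natCast_eq_natCast_iff]
    push_cast at h ⊢
    exact h
  have hm := isRearrangement_of_pow_seven_add h'
  unfold IsRearrangement at hm ⊢
  rwa [hinj.eq_iff ha hd, hinj.eq_iff ha he, hinj.eq_iff ha hf, hinj.eq_iff hb hd,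
    hinj.eq_iff hb he, hinj.eq_iff hb hf, hinj.eq_iff hc hd, hinj.eq_iff hc he,
    hinj.eq_iff hc hf] at hm

namespace IsGeneric

variable {α M : Type*} [AddCommGroup M] {r : α → M} {S : Set α}

theorem pair (hr : IsGeneric r S) {a b c d : α} (ha : a ∈ S) (hb : b ∈ S) (hc : c ∈ S)
    (hd : d ∈ S) (h : r a + r b = r c + r d) : a = c ∧ b = d ∨ a = d ∧ b = c := by
  have := hr a ha b hb a ha c hc d hd a ha (by rw [h])
  unfold IsRearrangement at this
  grind

theorem injOn (hr : IsGeneric r S) : InjOn r S := fun a ha b hb h => by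
  have := hr.pair ha ha hb hb (by rw [h])
  tauto

/-- A set with at least two elements is determined by its image up to a translation and a
reflection. -/
theorem eq_of_translate (hr : IsGeneric r S) {A B : Set α} (hA : A ⊆ S) (hB : B ⊆ S)
    (hA2 : A.Nontrivial) (t : M) (h : r '' A = (fun b => r b + t) '' B) : A = B := by
  obtain ⟨x, hx, y, hy, hxy⟩ := hA2
  obtain ⟨x', hx', hxx⟩ : r x ∈ (fun b => r b + t) '' B := h ▸ mem_image_of_mem r hx
  obtain ⟨y', hy', hyy⟩ : r y ∈ (fun b => r b + t) '' B := h ▸ mem_image_of_mem r hy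
  have key := hr.pair (hA hx) (hB hy') (hA hy) (hB hx') (by
    simp only at hxx hyy
    rw [← hxx, ← hyy]; abel)
  obtain rfl : x = x' := by tauto
  have ht : t = 0 := by simpa using hxx
  subst ht
  simp only [add_zero] at h
  exact hr.injOn.image_eq_image_iff hA hB |>.1 h

/-- Here `r x + r x' = t = r y + r y'`, so for `x ≠ y` the reflection must swap `x` and `y`. -/
theorem eq_of_reflect (hr : IsGeneric r S) {A B : Set α} (hA : A ⊆ S) (hB : B ⊆ S)
    (hA2 : A.Nontrivial) (t : M) (h : r '' A = (fun b => t - r b) '' B) : A = B := by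
  have key : ∀ x ∈ A, ∀ y ∈ A, x ≠ y → ∀ x' ∈ B, ∀ y' ∈ B, t - r x' = r x → t - r y' = r y →
      x = y' ∧ x' = y := by
    intro x hx y hy hxy x' hx' y' hy' h1 h2
    have := hr.pair (hA hx) (hB hx') (hA hy) (hB hy') (by rw [← h1, ← h2]; abel)
    tauto
  have hex : ∀ x ∈ A, ∃ x' ∈ B, t - r x' = r x := fun x hx => by
    have : r x ∈ (fun b => t - r b) '' B := h ▸ mem_image_of_mem r hx
    exact this
  apply Subset.antisymm
  · intro x hx
    obtain ⟨y, hy, hyx⟩ := hA2.exists_ne x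
    obtain ⟨x', hx', h1⟩ := hex x hx
    obtain ⟨y', hy', h2⟩ := hex y hy
    rwa [(key x hx y hy hyx.symm x' hx' y' hy' h1 h2).1]
  · intro x' hx'
    obtain ⟨x, hx, h1⟩ : t - r x' ∈ r '' A := h ▸ mem_image_of_mem (fun b => t - r b) hx'
    obtain ⟨y, hy, hyx⟩ := hA2.exists_ne x
    obtain ⟨y', hy', h2⟩ := hex y hy
    rwa [(key x hx y hy hyx.symm x' hx' y' hy' h1.symm h2).2]

/-- A set all of whose differences are differences of members of a generic family is a translate
of a part of the family or of its reflection. -/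
theorem subset_translate_or_reflect (hr : IsGeneric r S) (hS : S.Nonempty) {Q : Set M}
    (hQ : ∀ x ∈ Q, ∀ y ∈ Q, x ≠ y → ∃ a ∈ S, ∃ b ∈ S, y - x = r b - r a) :
    ∃ t : M, (∀ x ∈ Q, ∃ a ∈ S, x = r a + t) ∨ (∀ x ∈ Q, ∃ a ∈ S, x = t - r a) := by
  obtain ⟨z, hz⟩ := hS
  rcases Q.subsingleton_or_nontrivial with hsub | ⟨x, hx, y, hy, hxy⟩
  · rcases hsub.eq_empty_or_singleton with rfl | ⟨x, rfl⟩
    · exact ⟨0, by simp⟩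
    · exact ⟨x - r z, .inl fun w hw => ⟨z, hz, by simpa using hw⟩⟩
  obtain ⟨a, ha, b, hb, hab⟩ := hQ x hx y hy hxy
  have hne : a ≠ b := by
    rintro rfl
    exact hxy (by simpa [sub_eq_zero, eq_comm] using hab)
  have hyx : y = x + (r b - r a) := by rw [← hab]; abel
  -- Adding the differences around the triangle `x, y, w` gives equal sums of three; as no
  -- difference is trivial, those from `x` to `y` and to `w` share a start `a` or an end `b`.
  have hdich : ∀ w ∈ Q, (∃ d ∈ S, w = x + (r d - r a)) ∨ ∃ c ∈ S, w = x + (r b - r c) := by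
    intro w hw
    by_cases hwx : w = x
    · exact .inl ⟨a, ha, by simp [hwx]⟩
    by_cases hwy : w = y
    · exact .inl ⟨b, hb, by rw [hwy, hyx]⟩
    obtain ⟨c, hc, d, hd, hcd⟩ := hQ x hx w hw (Ne.symm hwx)
    obtain ⟨e, he, f, hf, hef⟩ := hQ y hy w hw (Ne.symm hwy)
    have hcd' : c ≠ d := by
      rintro rfl
      exact hwx (by simpa [sub_eq_zero] using hcd)
    have hef' : e ≠ f := by
      rintro rfl
      exact hwy (by simpa [sub_eq_zero] using hef)
    have hsum : r a + r d + r e = r c + r f + r b := by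
      have h1 : r d = w - x + r c := by rw [hcd]; abel
      have h2 : r f = w - y + r e := by rw [hef]; abel
      rw [h1, h2, hyx]; abel
    have hcase := hr a ha d hd e he c hc f hf b hb hsum
    have hw' : w = x + (r d - r c) := by rw [← hcd]; abel
    unfold IsRearrangement at hcase
    have : a = c ∨ d = b := by tauto
    rcases this with rfl | rfl
    · exact .inl ⟨d, hd, hw'⟩
    · exact .inr ⟨c, hc, hw'⟩
  by_cases hall : ∀ w ∈ Q, ∃ d ∈ S, w = x + (r d - r a)
  · refine ⟨x - r a, .inl fun w hw => ?_⟩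
    obtain ⟨d, hd, h⟩ := hall w hw
    exact ⟨d, hd, by rw [h]; abel⟩
  push Not at hall
  obtain ⟨w, hw, hwn⟩ := hall
  obtain ⟨c, hc, hwc⟩ := (hdich w hw).resolve_left fun ⟨d, hd, h⟩ => hwn d hd h
  have hca : c ≠ a := by
    rintro rfl
    exact hwn b hb hwc
  have hcb : c ≠ b := by
    rintro rfl
    exact hwn a ha (by rw [hwc]; abel)
  refine ⟨x + r b, .inr fun v hv => ?_⟩
  rcases hdich v hv with ⟨d, hd, hvd⟩ | ⟨d, hd, hvd⟩
  swap
  · exact ⟨d, hd, by rw [hvd]; abel⟩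
  -- The points `x` and `y` are of both kinds. Beyond them the kinds cannot mix: `d` and `c`, both
  -- outside `{a, b}`, would each have to be matched with the single term `k`.
  by_cases hda : d = a
  · exact ⟨b, hb, by rw [hvd, hda]; abel⟩
  by_cases hdb : d = b
  · exact ⟨a, ha, by rw [hvd, hdb]; abel⟩
  exfalso
  obtain ⟨g, hg, k, hk, hgk⟩ := hQ w hw v hv fun h => hwn d hd (h.trans hvd)
  have hsum : r d + r c + r g = r k + r a + r b := by
    have h1 : r k = v - w + r g := by rw [hgk]; abel
    rw [h1, hvd, hwc]; abel
  have hcase := hr d hd c hc g hg k hk a ha b hb hsum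
  unfold IsRearrangement at hcase
  grind

end IsGeneric

/-! ### Isomorphisms -/

theorem isIsomorphic_of_bijOn {α β : Type*} {H : Hypergraph α} {K : Hypergraph β} (g : α → β)
    (hg : BijOn g H.vertexSet K.vertexSet)
    (h : ∀ s ⊆ H.vertexSet, s ∈ H.edgeSet ↔ g '' s ∈ K.edgeSet) : H.IsIsomorphic K := by
  refine ⟨hg.equiv g, fun s => ?_⟩
  rw [h _ (by simp), Set.image_image, Set.image_image]
  rfl

theorem IsIsomorphic.symm {α β : Type*} {H : Hypergraph α} {K : Hypergraph β}
    (h : H.IsIsomorphic K) : K.IsIsomorphic H := by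
  obtain ⟨φ, hφ⟩ := h
  refine ⟨φ.symm, fun s => ?_⟩
  rw [hφ, Set.image_image φ]
  simp

theorem induce_vertexSet {α : Type*} (H : Hypergraph α) : H.induce H.vertexSet = H :=
  Hypergraph.ext rfl <| Set.ext fun _ =>
    ⟨fun h => h.1, fun h => ⟨h, subset_vertexSet_of_mem_edgeSet h⟩⟩

theorem induce_induce {α : Type*} (H : Hypergraph α) {X Y : Set α} (h : Y ⊆ X) :
    (H.induce X).induce Y = H.induce Y :=
  Hypergraph.ext rfl <| Set.ext fun _ =>
    ⟨fun he => ⟨he.1.1, he.2⟩, fun he => ⟨⟨he.1, he.2.trans h⟩, he.2⟩⟩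

/-! ### Coordinates on chains -/

/-- `q` is a coordinate on the chain `W`: its increments are the lengths `l`. -/
structure IsCoordinate {V M : Type*} [PartialOrder V] [Add M] (l : V → V → M) (q : V → M)
    (W : Set V) : Prop where
  isChain : IsChain (· ≤ ·) W
  eq_add : ∀ u ∈ W, ∀ v ∈ W, u ≤ v → q v = q u + l u v

section Coordinate

variable {V M : Type*} [PartialOrder V] [AddCommGroup M] {l : V → V → M} {q q' : V → M}
  {W X : Set V}

theorem IsCoordinate.mono (h : IsCoordinate l q X) (hW : W ⊆ X) : IsCoordinate l q W :=
  ⟨h.isChain.mono hW, fun u hu v hv => h.eq_add u (hW hu) v (hW hv)⟩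

theorem IsCoordinate.add_const (h : IsCoordinate l q X) (t : M) :
    IsCoordinate l (fun v => q v + t) X :=
  ⟨h.isChain, fun u hu v hv huv => by rw [h.eq_add u hu v hv huv]; abel⟩

theorem IsCoordinate.sub_eq_sub (h : IsCoordinate l q X) (h' : IsCoordinate l q' X) {u v : V}
    (hu : u ∈ X) (hv : v ∈ X) : q v - q u = q' v - q' u := by
  rcases h.isChain.total hu hv with huv | huv
  · rw [h.eq_add u hu v hv huv, h'.eq_add u hu v hv huv]; abel
  · rw [h.eq_add v hv u hu huv, h'.eq_add v hv u hu huv]; abel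

theorem IsCoordinate.exists_eq_add (h : IsCoordinate l q X) (h' : IsCoordinate l q' X) :
    ∃ t, ∀ v ∈ X, q' v = q v + t := by
  rcases X.eq_empty_or_nonempty with rfl | ⟨u, hu⟩
  · exact ⟨0, by simp⟩
  · refine ⟨q' u - q u, fun v hv => ?_⟩
    have := h.sub_eq_sub h' hu hv
    rw [sub_eq_iff_eq_add] at this
    rw [this]; abel

theorem IsAdditiveLength.exists_isCoordinate (hl : IsAdditiveLength l)
    (hX : IsChain (· ≤ ·) X) : ∃ q, IsCoordinate l q X := by
  classical
  rcases X.eq_empty_or_nonempty with rfl | ⟨x, hx⟩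
  · exact ⟨fun _ => 0, hX, by simp⟩
  refine ⟨fun v => if x ≤ v then l x v else - l v x, hX, fun u hu v hv huv => ?_⟩
  by_cases hxu : x ≤ u
  · simp only [hxu, hxu.trans huv, if_true]
    exact hl hxu huv
  · have hux := (hX.total hx hu).resolve_left hxu
    by_cases hxv : x ≤ v
    · simp only [hxu, hxv, if_true, if_false]
      rw [hl hux hxv]; abel
    · have hvx := (hX.total hx hv).resolve_left hxv
      simp only [hxu, hxv, if_false]
      rw [hl huv hvx]; abel

end Coordinate

/-- Along a walk of `p` steps of the same nonzero length, every family of residues modulo `p` is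
attained by a coordinate. -/
theorem IsAdditiveLength.exists_of_walk {α V : Type*} [PartialOrder V] {p : ℕ} [Fact p.Prime]
    {l : V → V → ZMod p} (hl : IsAdditiveLength l) (r : α → ZMod p) {x : ℕ → V} {d : ZMod p}
    (hd : d ≠ 0) (hx : ∀ i < p, x i < x (i + 1) ∧ l (x i) (x (i + 1)) = d) :
    ∃ (g : α → V) (q : V → ZMod p), (∀ a, ∃ i < p, g a = x i) ∧ IsCoordinate l q (range g) ∧
      ∀ a, q (g a) = r a := by
  have hmono : ∀ i j, i ≤ j → j ≤ p → x i ≤ x j ∧ l (x i) (x j) = ((j - i : ℕ) : ZMod p) * d := by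
    intro i j hij
    induction j, hij using Nat.le_induction with
    | base => intro _; simp [hl.self]
    | succ j hij ih =>
      intro hj
      obtain ⟨h1, h2⟩ := ih (by omega)
      obtain ⟨h3, h4⟩ := hx j (by omega)
      refine ⟨h1.trans h3.le, ?_⟩
      rw [hl h1 h3.le, h2, h4, Nat.succ_sub hij]
      push_cast
      ring
  -- After `i` steps the coordinate is `i * d`, so the residue `r a` occurs at index `r a / d`.
  have hlt : ∀ a, (r a / d).val < p := fun a => ZMod.val_lt _
  refine ⟨fun a => x (r a / d).val, l (x 0), fun a => ⟨_, hlt a, rfl⟩, ⟨?_, ?_⟩, fun a => ?_⟩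
  · rintro _ ⟨a, rfl⟩ _ ⟨b, rfl⟩ -
    rcases le_total (r a / d).val (r b / d).val with h | h
    · exact .inl (hmono _ _ h (hlt b).le).1
    · exact .inr (hmono _ _ h (hlt a).le).1
  · rintro _ ⟨a, rfl⟩ v - huv
    exact hl (hmono 0 _ (Nat.zero_le _) (hlt a).le).1 huv
  · rw [(hmono 0 _ (Nat.zero_le _) (hlt a).le).2]
    simp [hd]

/-! ### The hypergraph of chains -/

/-- Undoing `ε` leaves a translation or a reflection. Hence a chain cannot represent two different
vertex sets of `F`, and non-edges stay non-edges. -/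
theorem IsGeneric.eq_of_smul {α M : Type*} [AddCommGroup M] {r : α → M} {S : Set α}
    (hr : IsGeneric r S) {A B : Set α} (hA : A ⊆ S) (hB : B ⊆ S) (hA2 : A.Nontrivial)
    (ε δ : ℤˣ) (t : M) (h : (fun a => ε • r a) '' A = (fun b => δ • r b + t) '' B) : A = B := by
  have h' : r '' A = (fun b => ε⁻¹ • (δ • r b + t)) '' B := by
    have := congrArg (image (ε⁻¹ • ·)) h
    simpa only [Set.image_image, inv_smul_smul] using this
  simp only [smul_add, smul_smul] at h'
  rcases Int.units_eq_one_or (ε⁻¹ * δ) with h1 | h1 <;> rw [h1] at h'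
  · exact hr.eq_of_translate hA hB hA2 (ε⁻¹ • t) (by simpa using h')
  · refine hr.eq_of_reflect hA hB hA2 (ε⁻¹ • t) (h'.trans (image_congr fun b _ => ?_))
    rw [Units.neg_smul, one_smul]; abel

/-- The hypergraph on `V` whose edges are the chains that have a coordinate identifying them with
an edge of `F` or with its reflection, where `r` places the vertices of `F` in `M`. -/
def chainHypergraph {α V M : Type*} [PartialOrder V] [AddCommGroup M] (F : Hypergraph α)
    (r : α → M) (l : V → V → M) : Hypergraph V where
  vertexSet := univ
  edgeSet := {W | ∃ q, IsCoordinate l q W ∧ InjOn q W ∧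
    ∃ e ∈ F.edgeSet, ∃ ε : ℤˣ, q '' W = (fun a => ε • r a) '' e}
  subset_vertexSet_of_mem_edgeSet' := fun _ _ => subset_univ _

section ChainHypergraph

variable {α V M : Type*} [PartialOrder V] [AddCommGroup M] {F : Hypergraph α} {r : α → M}
  {l : V → V → M}

theorem IsGeneric.injOn_smul (hr : IsGeneric r F.vertexSet) (ε : ℤˣ) :
    InjOn (fun a => ε • r a) F.vertexSet := fun _ ha _ hb h =>
  hr.injOn ha hb (MulAction.injective ε h)

theorem isStandard_chainHypergraph [Finite V] (hF : F.IsStandard)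
    (hr : IsGeneric r F.vertexSet) : (chainHypergraph F r l).IsStandard where
  finite_vertexSet := toFinite _
  two_le_encard := by
    rintro W ⟨q, -, hinj, e, he, ε, h⟩
    rw [← hinj.encard_image, h,
      ((hr.injOn_smul ε).mono (subset_vertexSet_of_mem_edgeSet he)).encard_image]
    exact hF.two_le_encard e he

/-- A chain with a coordinate identifying it with a set of vertices of `F` or with its reflection
induces the same hypergraph as that set. -/
theorem isIsomorphic_induce_chainHypergraph (hF : F.IsStandard) (hr : IsGeneric r F.vertexSet)
    {C : Set α} (hC : C ⊆ F.vertexSet) {g : α → V} {q : V → M} (ε : ℤˣ)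
    (hq : IsCoordinate l q (g '' C)) (hqg : ∀ a ∈ C, q (g a) = ε • r a) :
    (F.induce C).IsIsomorphic ((chainHypergraph F r l).induce (g '' C)) := by
  have hinj : InjOn q (g '' C) := by
    rintro _ ⟨a, ha, rfl⟩ _ ⟨b, hb, rfl⟩ h
    rw [hqg a ha, hqg b hb] at h
    rw [hr.injOn_smul ε (hC ha) (hC hb) h]
  have hg : InjOn g C := fun a ha b hb h =>
    hr.injOn_smul ε (hC ha) (hC hb) (by simp only [← hqg a ha, ← hqg b hb, h])
  refine isIsomorphic_of_bijOn g hg.bijOn_image fun s hs => ?_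
  have himg : q '' (g '' s) = (fun a => ε • r a) '' s := by
    rw [Set.image_image]
    exact image_congr fun a ha => hqg a (hs ha)
  have hsub : g '' s ⊆ g '' C := image_mono hs
  constructor
  · rintro ⟨he, -⟩
    exact ⟨⟨q, hq.mono hsub, hinj.mono hsub, s, he, ε, himg⟩, hsub⟩
  · rintro ⟨⟨q', hq', -, e, he, δ, h⟩, -⟩
    -- The coordinate witnessing the edge may differ from `q`, but only by a translation.
    obtain ⟨t, ht⟩ := (hq.mono hsub).exists_eq_add hq'
    have h2 : e.Nontrivial := one_lt_encard_iff_nontrivial.1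
      (lt_of_lt_of_le (by norm_num) (hF.two_le_encard e he))
    have hes : e = s := by
      refine hr.eq_of_smul (subset_vertexSet_of_mem_edgeSet he) (hs.trans hC) h2 δ ε t ?_
      rw [← h, image_congr ht, Set.image_image]
      exact image_congr fun a ha => by rw [hqg a (hs ha)]
    exact ⟨hes ▸ he, hs⟩

/-- The pairwise covered sets of the hypergraph of chains induce subhypergraphs of `F`. -/
theorem isInducedSubhypergraph_of_coversPairs [Nonempty V] (hF : F.IsStandard) (hFn : F.vertexSet.Nonempty)
    (hr : IsGeneric r F.vertexSet) (hl : IsAdditiveLength l) {X : Set V}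
    (hX : (chainHypergraph F r l).CoversPairs X) :
    ((chainHypergraph F r l).induce X).IsInducedSubhypergraph F := by
  have hchain : IsChain (· ≤ ·) X := by
    intro u hu v hv huv
    obtain ⟨W, ⟨q, hq, -⟩, huW, hvW⟩ := hX hu hv huv
    exact hq.isChain huW hvW huv
  obtain ⟨q, hq⟩ := hl.exists_isCoordinate hchain
  have hdiff : ∀ u ∈ X, ∀ v ∈ X, u ≠ v → q u ≠ q v ∧
      ∃ a ∈ F.vertexSet, ∃ b ∈ F.vertexSet, q v - q u = r b - r a := by
    intro u hu v hv huv
    obtain ⟨W, ⟨q', hq', hinj, e, he, ε, h⟩, huW, hvW⟩ := hX hu hv huv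
    have hsub : ({u, v} : Set V) ⊆ X := by simp [insert_subset_iff, hu, hv]
    have hsub' : ({u, v} : Set V) ⊆ W := by simp [insert_subset_iff, huW, hvW]
    have hqq : q v - q u = q' v - q' u :=
      (hq.mono hsub).sub_eq_sub (hq'.mono hsub') (by simp) (by simp)
    obtain ⟨a, ha, hau⟩ : q' u ∈ (fun a => ε • r a) '' e := h ▸ mem_image_of_mem q' huW
    obtain ⟨b, hb, hbv⟩ : q' v ∈ (fun a => ε • r a) '' e := h ▸ mem_image_of_mem q' hvW
    have haF := mem_vertexSet_of_mem_edgeSet he ha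
    have hbF := mem_vertexSet_of_mem_edgeSet he hb
    refine ⟨fun h0 => huv (hinj huW hvW ?_), ?_⟩
    · rw [h0, sub_self] at hqq
      exact (sub_eq_zero.1 hqq.symm).symm
    · rw [hqq, ← hau, ← hbv]
      rcases Int.units_eq_one_or ε with rfl | rfl
      · exact ⟨a, haF, b, hbF, by simp⟩
      · exact ⟨b, hbF, a, haF, by simp only [Units.neg_smul, one_smul]; abel⟩
  have hcover : ∃ (ε : ℤˣ) (t : M), ∀ v ∈ X, ∃ a ∈ F.vertexSet, q v + t = ε • r a := by
    obtain ⟨t, ht | ht⟩ := hr.subset_translate_or_reflect hFn (Q := q '' X) (by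
      rintro _ ⟨u, hu, rfl⟩ _ ⟨v, hv, rfl⟩ huv
      exact (hdiff u hu v hv fun h => huv (h ▸ rfl)).2)
    · refine ⟨1, -t, fun v hv => ?_⟩
      obtain ⟨a, ha, h⟩ := ht _ (mem_image_of_mem q hv)
      exact ⟨a, ha, by rw [h]; simp⟩
    · refine ⟨-1, -t, fun v hv => ?_⟩
      obtain ⟨a, ha, h⟩ := ht _ (mem_image_of_mem q hv)
      exact ⟨a, ha, by rw [h, Units.neg_smul, one_smul]; abel⟩
  obtain ⟨ε, t, hcover⟩ := hcover
  have : Nonempty α := ⟨hFn.some⟩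
  choose! f hfF hf using hcover
  have hfinj : InjOn f X := by
    intro u hu v hv huv
    by_contra hne
    refine (hdiff u hu v hv hne).1 (add_right_cancel (b := t) ?_)
    rw [hf u hu, hf v hv, huv]
  have hleft : ∀ v ∈ X, Function.invFunOn f X (f v) = v := fun v hv => hfinj.leftInvOn_invFunOn hv
  have hback : Function.invFunOn f X '' (f '' X) = X := hfinj.invFunOn_image subset_rfl
  refine ⟨f '' X, image_subset_iff.2 hfF, ?_⟩
  have := isIsomorphic_induce_chainHypergraph (l := l) hF hr (C := f '' X)
    (g := Function.invFunOn f X) (q := fun v => q v + t) (image_subset_iff.2 hfF) ε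
    (by rw [hback]; exact hq.add_const t) (by
      rintro _ ⟨v, hv, rfl⟩
      rw [hleft v hv, hf v hv])
  rw [hback] at this
  exact this.symm

end ChainHypergraph

/-! ### Colourings of the hypergraph of chains -/

section Coloring

variable {α V : Type*} [PartialOrder V] {p : ℕ} [Fact p.Prime] {F : Hypergraph α}
  {r : α → ZMod p} {l : V → V → ZMod p}

/-- An `F`-free induced subhypergraph of the hypergraph of chains has a strong colouring: for every
nonzero `d` the steps of length `d` in it form no walk with `p` steps. -/
theorem isStronglyColorable_of_isFree (hF : F.IsStandard) (hr : IsGeneric r F.vertexSet)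
    (hl : IsAdditiveLength l) {X : Set V}
    (hX : ((chainHypergraph F r l).induce X).IsFree F) :
    ((chainHypergraph F r l).induce X).IsStronglyColorable
      (Nat.card ({d : ZMod p // d ≠ 0} → Fin p)) := by
  have hf : ∀ d : {d : ZMod p // d ≠ 0}, ∃ f : X → Fin p, ∀ u v : X,
      u.1 < v.1 ∧ l u v = d → f u < f v := by
    rintro ⟨d, hd⟩
    refine exists_lt_of_no_walk (fun u v : X => u.1 < v.1 ∧ l u v = d) p ?_
    rintro ⟨x, hx⟩
    obtain ⟨g, q, hg, hq, hqg⟩ := hl.exists_of_walk r (x := fun i => (x i).1) hd hx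
    have hgX : g '' F.vertexSet ⊆ X := by
      rintro _ ⟨a, -, rfl⟩
      obtain ⟨i, -, hi⟩ := hg a
      exact hi ▸ (x i).2
    refine hX ⟨g '' F.vertexSet, hgX, ?_⟩
    have := isIsomorphic_induce_chainHypergraph (l := l) hF hr subset_rfl 1
      (hq.mono (image_subset_range g _)) fun a _ => by rw [hqg a, one_smul]
    rwa [induce_vertexSet, ← induce_induce _ hgX] at this
  choose f hf using hf
  have hne : ∀ u v : X, u.1 < v.1 → (chainHypergraph F r l).Adj u v → ∃ d, f d u < f d v := by
    rintro u v huv ⟨W, ⟨q, hq, hinj, -⟩, hu, hv⟩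
    -- Coordinates are injective on edges, so this distance is nonzero and indexes a label.
    refine ⟨⟨l u v, fun h0 => huv.ne (hinj hu hv ?_)⟩, hf _ u v ⟨huv, rfl⟩⟩
    rw [hq.eq_add u hu v hv huv.le, h0, add_zero]
  refine ⟨fun v => Finite.equivFin _ fun d => f d v, ?_⟩
  rintro W ⟨hW, -⟩ u v hu hv huv h
  have heq := (Finite.equivFin _).injective h
  have hW' := hW
  obtain ⟨q, hq, -⟩ := hW'
  rcases hq.isChain.total hu hv with hle | hle
  · obtain ⟨d, hd⟩ := hne u v (hle.lt_of_ne fun h => huv (Subtype.ext h)) ⟨W, hW, hu, hv⟩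
    exact hd.ne (congrFun heq d)
  · obtain ⟨d, hd⟩ := hne v u (hle.lt_of_ne fun h => huv (Subtype.ext h.symm)) ⟨W, hW, hv, hu⟩
    exact hd.ne (congrFun heq d).symm

/-- If the steps of length one form a graph that is not `n * p`-colourable, then the hypergraph of
chains is not `n`-colourable. -/
theorem not_isColorable_chainHypergraph (hFe : F.edgeSet.Nonempty)
    (hr : IsGeneric r F.vertexSet) (hl : IsAdditiveLength l) {n : ℕ}
    (hV : ∀ κ : V → Fin (n * p), ∃ u v, u < v ∧ l u v = 1 ∧ κ u = κ v) :
    ¬ (chainHypergraph F r l).IsColorable n := by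
  rintro ⟨κ, hκ⟩
  have hwalk : ∃ x : ℕ → V, ∀ i < p, (x i < x (i + 1) ∧ l (x i) (x (i + 1)) = 1) ∧
      κ ⟨x i, mem_univ _⟩ = κ ⟨x (i + 1), mem_univ _⟩ := by
    by_contra hno
    obtain ⟨f, hf⟩ := exists_lt_of_no_walk
      (fun u v => (u < v ∧ l u v = 1) ∧ κ ⟨u, mem_univ _⟩ = κ ⟨v, mem_univ _⟩) p hno
    -- Without a long monochromatic walk, the colour paired with the walk label properly colours the
    -- unit steps.
    obtain ⟨u, v, huv, h1, h⟩ := hV fun v => finProdFinEquiv (κ ⟨v, mem_univ _⟩, f v)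
    rw [finProdFinEquiv.injective.eq_iff, Prod.mk.injEq] at h
    exact (hf u v ⟨⟨huv, h1⟩, h.1⟩).ne h.2
  obtain ⟨x, hx⟩ := hwalk
  have hconst : ∀ i ≤ p, κ ⟨x i, mem_univ _⟩ = κ ⟨x 0, mem_univ _⟩ := by
    intro i
    induction i with
    | zero => simp
    | succ i ih => exact fun hi => (hx i (by omega)).2.symm.trans (ih (by omega))
  obtain ⟨g, q, hg, hq, hqg⟩ := hl.exists_of_walk r one_ne_zero fun i hi => (hx i hi).1
  obtain ⟨e, he⟩ := hFe
  have hinj : InjOn q (g '' e) := by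
    rintro _ ⟨a, ha, rfl⟩ _ ⟨b, hb, rfl⟩ h
    rw [hqg, hqg] at h
    rw [hr.injOn (mem_vertexSet_of_mem_edgeSet he ha) (mem_vertexSet_of_mem_edgeSet he hb) h]
  refine hκ (g '' e) ⟨q, hq.mono (image_subset_range g e), hinj, e, he, 1, ?_⟩
    ⟨κ ⟨x 0, mem_univ _⟩, ?_⟩
  · rw [Set.image_image]
    exact image_congr fun a _ => by rw [hqg, one_smul]
  · rintro ⟨_, _⟩ ⟨a, -, rfl⟩
    obtain ⟨i, hi, hgi⟩ := hg a
    simp only [hgi]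
    exact hconst i hi.le

end Coloring

/-! ### Chromatic number bounds and the choice of the prime -/

theorem IsStandard.nonempty {α : Type*} {H : Hypergraph α} (hH : H.IsStandard) {e : Set α}
    (he : e ∈ H.edgeSet) : e.Nonempty :=
  encard_pos.1 (lt_of_lt_of_le (by norm_num) (hH.two_le_encard e he))

theorem IsColorable.mono {α : Type*} {H : Hypergraph α} (hH : H.IsStandard) {m n : ℕ}
    (h : H.IsColorable m) (hmn : m ≤ n) : H.IsColorable n := by
  obtain ⟨κ, hκ⟩ := h
  refine ⟨fun v => Fin.castLE hmn (κ v), fun e he ⟨i, hi⟩ => hκ e he ?_⟩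
  obtain ⟨v, hv⟩ := hH.nonempty he
  exact ⟨κ ⟨v, mem_vertexSet_of_mem_edgeSet he hv⟩, fun w hw =>
    Fin.castLE_injective hmn ((hi w hw).trans (hi _ hv).symm)⟩

theorem le_chromaticNumber_of_not_isColorable {α : Type*} {H : Hypergraph α} (hH : H.IsStandard)
    {n : ℕ} (h : ¬ H.IsColorable n) : (n : ℕ∞) ≤ H.chromaticNumber := by
  refine le_iInf₂ fun m hm => ?_
  by_contra hlt
  exact h (IsColorable.mono hH hm (by exact_mod_cast (not_le.1 hlt).le))

theorem exists_isGeneric {α : Type*} {S : Set α} (hS : S.Finite) :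
    ∃ (p : ℕ) (_ : Fact p.Prime) (r : α → ZMod p), IsGeneric r S := by
  obtain ⟨idx, hidx⟩ := countable_iff_exists_injOn.1 hS.countable
  obtain ⟨k, hk⟩ := (hS.image idx).bddAbove
  obtain ⟨p, hp, hprime⟩ := Nat.exists_infinite_primes (3 * 7 ^ (k + 1) + 1)
  exact ⟨p, ⟨hprime⟩, _, isGeneric_pow_seven hidx
    (fun a ha => Nat.lt_succ_of_le (hk (mem_image_of_mem idx ha))) hp⟩

end Hypergraph

open Hypergraph

theorem theorem1p8 {α : Type*} (F : Hypergraph α) (hF : F.IsStandard)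
    (hFe : F.edgeSet.Nonempty) :
    ∃ c : ℕ, ∀ n : ℕ, ∃ (β : Type) (G : Hypergraph β),
      G.IsStandard ∧
      (n : ℕ∞) ≤ G.chromaticNumber ∧
      (∀ X ⊆ G.vertexSet, (G.induce X).IsFree F → (G.induce X).IsStronglyColorable c) ∧
      (∀ X ⊆ G.vertexSet, G.CoversPairs X → (G.induce X).IsInducedSubhypergraph F) := by
  obtain ⟨p, _, r, hr⟩ := exists_isGeneric hF.finite_vertexSet
  have hFn : F.vertexSet.Nonempty := by
    obtain ⟨e, he⟩ := hFe
    exact (hF.nonempty he).mono (subset_vertexSet_of_mem_edgeSet he)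
  -- The prime depends on `F` alone, hence so does the constant; only the order depends on `n`.
  refine ⟨Nat.card ({d : ZMod p // d ≠ 0} → Fin p), fun n => ?_⟩
  obtain ⟨V, _, _, _, l, hl, hV⟩ := exists_additiveLength_not_colorable (ZMod p) (n * p)
  have hG := isStandard_chainHypergraph (l := l) hF hr
  exact ⟨V, chainHypergraph F r l, hG,
    le_chromaticNumber_of_not_isColorable hG (not_isColorable_chainHypergraph hFe hr hl hV),
    fun _ _ hX => isStronglyColorable_of_isFree hF hr hl hX,
    fun _ _ hX => isInducedSubhypergraph_of_coversPairs hF hFn hr hl hX⟩
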